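/- **Proposition (graphical characterization of possibly-optimal intervention sets).** *Setting.* Let $\mathcal G$ be a causal diagram over a finite vertex set $\mathbf V$, i.e. a directed acyclic graph together with bidirected edges between distinct vertices, and let $Y\in\mathbf V$ be the reward variable. Write $\mathrm{Pa},\mathrm{An},\mathrm{De}$ for parents, ancestors and descendants along directed edges ($\mathrm{An}(\mathbf S)$ and $\mathrm{De}(\mathbf S)$ contain $\mathbf S$), and $\mathsf{CC}(\mathbf S)$ for the union of the connected components of the bidirected part that meet $\mathbf S$. $\mathcal G[\mathbf S]$ is the induced subgraph, and $\mathcal G_{\overline{\mathbf X}}$ is $\mathcal G$ with all directed edges into $\mathbf X$ and all bidirected edges with an endpoint in $\mathbf X$ removed. A set $\mathbf T\subseteq \mathrm{An}(Y)_{\mathcal G}$ with $Y\in\mathbf T$ is a *UC-territory* if, in $\mathcal H=\mathcal G[\mathrm{An}(Y)_{\mathcal G}]$, $\mathrm{De}(\mathbf T)_{\mathcal H}=\mathbf T$ and $\mathsf{CC}(\mathbf T)_{\mathcal H}=\mathbf T$. $\mathsf{MUCT}(\mathcal G,Y)$ is the (unique) minimal UC-territory, and $\mathsf{IB}(\mathcal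 G,Y)=\mathrm{Pa}(\mathbf T)_{\mathcal G}\setminus\mathbf T$ for $\mathbf T=\mathsf{MUCT}(\mathcal G,Y)$. An *SCM conforming to $\mathcal G$* has endogenous variables $\mathbf V$ with finite nonempty domains $\Omega_V$ ($Y$ real-valued), finitely many mutually independent exogenous variables, and for each $V\in\mathbf V$ a measurable mechanism whose arguments are the parents of $V$ in $\mathcal G$ and a set $\mathbf U_V$ of exogenous variables, such that for distinct $V,W$ one has $V\leftrightarrow W$ in $\mathcal G$ iff $\mathbf U_V\cap\mathbf U_W\neq\emptyset$. For $\mathbf X\subseteq\mathbf V\setminus\{Y\}$ and $\mathbf x\in\Omega_{\mathbf X}$ let $\mathbb E_{P_{\mathbf x}}Y$ be the expected reward under $do(\mathbf X=\mathbf x)$, and let $\mu^*_{\mathbf X}=\max_{\mathbf x\in\Omega_{\mathbf X}}\mathbb E_{P_{\mathbf x}}Y$. Sets $\mathbf X,\mathbf X'\subseteq\mathbf V\setminus\{Y\}$ are *equivalent* if $\mathbb E_{P_{\mathbf v[\mathbf X]}}Y=\mathbb E_{P_{\mathbf v[\mathbf X']}}Y$ for every SCM conforming to $\mathcal G$ and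 every assignment $\mathbf v\in\Omega_{\mathbf V}$, where $\mathbf v[\mathbf S]$ is the restriction of $\mathbf v$ to $\mathbf S$. A set $\mathbf X\subseteq\mathbf V\setminus\{Y\}$ is - a *minimal intervention set* (MIS) if it is not equivalent to any proper subset of itself; - a *possibly-optimal minimal intervention set* (POMIS) if it is an MIS and there is an SCM conforming to $\mathcal G$ in which $\mu^*_{\mathbf W}<\mu^*_{\mathbf X}$ for every MIS $\mathbf W\neq\mathbf X$; - a *possibly-optimal intervention set* (POIS) if there is an SCM conforming to $\mathcal G$ in which $\mu^*_{\mathbf W}<\mu^*_{\mathbf X}$ for every $\mathbf W\subseteq\mathbf V\setminus\{Y\}$ that is not equivalent to $\mathbf X$. *Claim.* Let $\mathbf X\subseteq\mathbf V\setminus\{Y\}$ and $\mathbf T_{\mathbf X}=\mathsf{MUCT}(\mathcal G_{\overline{\mathbf X}},Y)$. 1. If $\mathbf X$ is a POIS, then $\mathsf{IB}(\mathcal G_{\overline{\mathbf X}},Y)\subseteq\mathbf X$. 2. $\mathbf X$ is a POIS consisting of ancestors of $Y$ in $\mathcal G$ (i.e. $\mathbf X\subseteq\mathrm{An}(Y)_{\mathcal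 G}$) if and only if $$\mathsf{IB}(\mathcal G_{\overline{\mathbf X}},Y)\subseteq\mathbf X\subseteq\mathrm{An}(\mathbf T_{\mathbf X})_{\mathcal G}\setminus\mathbf T_{\mathbf X}.$$ 3. If $\mathbf X=\mathsf{IB}(\mathcal G_{\overline{\mathbf X}},Y)$, then $\mathbf X$ is a POMIS. -/

import Mathlib

open MeasureTheory

/-- A causal diagram (acyclic directed mixed graph): a directed acyclic graph `dir`
(`dir v w` means `v → w`) together with bidirected edges `v ↔ w`, which stand for unobserved
confounding. -/
structure CausalDiagram (V : Type*) where
  dir : V → V → Prop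
  bidir : SimpleGraph V
  acyclic : ∀ v, ¬ Relation.TransGen dir v v

namespace CausalDiagram

variable {V : Type*}

/-- `An(S)_G`: the ancestors of members of `S`, including `S` itself. -/
def An (G : CausalDiagram V) (S : Set V) : Set V :=
  {v | ∃ s ∈ S, Relation.ReflTransGen G.dir v s}

/-- `De(S)_G`: the descendants of members of `S`, including `S` itself. -/
def De (G : CausalDiagram V) (S : Set V) : Set V :=
  {v | ∃ s ∈ S, Relation.ReflTransGen G.dir s v}

/-- `Pa(S)_G`: the parents of members of `S`. -/
def Pa (G : CausalDiagram V) (S : Set V) : Set V :=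
  {v | ∃ s ∈ S, G.dir v s}

/-- `CC(S)_G`: the union of the maximal c-components (connected components of the bidirected part)
that meet `S`. -/
def CC (G : CausalDiagram V) (S : Set V) : Set V :=
  {v | ∃ s ∈ S, G.bidir.Reachable s v}

/-- The induced subgraph `G[S]`.  The vertex type is kept, so that the vertices outside `S` are
isolated; the sets of vertices considered in `G[S]` are always subsets of `S`. -/
def induce (G : CausalDiagram V) (S : Set V) : CausalDiagram V where
  dir v w := v ∈ S ∧ w ∈ S ∧ G.dir v w
  bidir :=
    { Adj := fun v w => v ∈ S ∧ w ∈ S ∧ G.bidir.Adj v w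
      symm := ⟨fun _ _ h => ⟨h.2.1, h.1, h.2.2.symm⟩⟩
      loopless := ⟨fun v h => G.bidir.irrefl h.2.2⟩ }
  acyclic _ h := G.acyclic _ (Relation.TransGen.mono (fun _ _ h => h.2.2) _ _ h)

/-- `G_{\overline X}`: all edges with an arrowhead at a member of `X` are deleted, that is, the
directed edges into `X` and the bidirected edges with an endpoint in `X`. -/
def removeIncoming (G : CausalDiagram V) (X : Set V) : CausalDiagram V where
  dir v w := w ∉ X ∧ G.dir v w
  bidir :=
    { Adj := fun v w => v ∉ X ∧ w ∉ X ∧ G.bidir.Adj v w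
      symm := ⟨fun _ _ h => ⟨h.2.1, h.1, h.2.2.symm⟩⟩
      loopless := ⟨fun v h => G.bidir.irrefl h.2.2⟩ }
  acyclic _ h := G.acyclic _ (Relation.TransGen.mono (fun _ _ h => h.2) _ _ h)

/-- `T` is an unobserved-confounders' territory on `G` with respect to `Y`. -/
def IsUCTerritory (G : CausalDiagram V) (Y : V) (T : Set V) : Prop :=
  Y ∈ T ∧ T ⊆ G.An {Y} ∧
    (G.induce (G.An {Y})).De T = T ∧ (G.induce (G.An {Y})).CC T = T

/-- `MUCT(G, Y)`: the minimal UC-territory, as the intersection of all UC-territories;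
see `minimal_muct` and `eq_muct_of_minimal`. -/
def MUCT (G : CausalDiagram V) (Y : V) : Set V :=
  ⋂₀ {T | G.IsUCTerritory Y T}

/-- `IB(G, Y)`, the interventional border. -/
def IB (G : CausalDiagram V) (Y : V) : Set V :=
  G.Pa (G.MUCT Y) \ G.MUCT Y

theorem isUCTerritory_an (G : CausalDiagram V) (Y : V) : G.IsUCTerritory Y (G.An {Y}) := by
  refine ⟨⟨Y, rfl, .refl⟩, subset_rfl, ?_, ?_⟩
  · refine subset_antisymm ?_ fun v hv => ⟨v, hv, .refl⟩
    rintro v ⟨s, hs, h⟩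
    induction h with
    | refl => exact hs
    | tail _ h _ =>
      obtain ⟨_, h, _⟩ := h
      exact h
  · refine subset_antisymm ?_ fun v hv => ⟨v, hv, .refl v⟩
    rintro v ⟨s, hs, ⟨p⟩⟩
    induction p with
    | nil => exact hs
    | cons h _ ih =>
      obtain ⟨_, h, _⟩ := h
      exact ih h

theorem isUCTerritory_muct (G : CausalDiagram V) (Y : V) : G.IsUCTerritory Y (G.MUCT Y) := by
  refine ⟨fun T hT => hT.1, fun v hv => hv _ (G.isUCTerritory_an Y), ?_, ?_⟩
  · refine subset_antisymm ?_ fun v hv => ⟨v, hv, .refl⟩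
    rintro v ⟨s, hs, h⟩ T hT
    rw [← hT.2.2.1]
    exact ⟨s, hs T hT, h⟩
  · refine subset_antisymm ?_ fun v hv => ⟨v, hv, .refl v⟩
    rintro v ⟨s, hs, h⟩ T hT
    rw [← hT.2.2.2]
    exact ⟨s, hs T hT, h⟩

/-- `MUCT(G, Y)` is a UC-territory no proper subset of which is one. -/
theorem minimal_muct (G : CausalDiagram V) (Y : V) : Minimal (G.IsUCTerritory Y) (G.MUCT Y) :=
  ⟨G.isUCTerritory_muct Y, fun _ hT _ => Set.sInter_subset_of_mem hT⟩

theorem eq_muct_of_minimal (G : CausalDiagram V) (Y : V) (T : Set V)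
    (hT : Minimal (G.IsUCTerritory Y) T) : T = G.MUCT Y :=
  subset_antisymm (hT.2 (G.isUCTerritory_muct Y) (Set.sInter_subset_of_mem hT.1))
    (Set.sInter_subset_of_mem hT.1)

theorem wellFounded_dir [Finite V] (G : CausalDiagram V) : WellFounded G.dir := by
  have : Std.Irrefl (Relation.TransGen G.dir) := ⟨G.acyclic⟩
  exact Subrelation.wf (fun h => Relation.TransGen.single h)
    (Finite.wellFounded_of_trans_of_irrefl (Relation.TransGen G.dir))

end CausalDiagram

/-- A structural causal model conforming to the causal diagram `G`, with reward variable `Y`.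
* The endogenous variables are the vertices; they have finite nonempty domains `Ω v`, and the
  reward is real valued: its domain is identified with a finite set of reals by `val`.
* The exogenous variables `j : ι` take values in arbitrary probability spaces and are mutually
  independent.
* The mechanism `f v` of `v` is a measurable function of the parents of `v` in `G` and of the
  exogenous variables `exo v`.
* Two distinct variables are joined by a bidirected edge of `G` exactly if they share an exogenous
  variable. -/
structure SCM {V : Type*} (G : CausalDiagram V) (Y : V) where
  Ω : V → Type
  finite_Ω : ∀ v, Finite (Ω v)
  nonempty_Ω : ∀ v, Nonempty (Ω v)
  val : Ω Y → ℝ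
  val_injective : Function.Injective val
  ι : Type
  fintype_ι : Fintype ι
  D : ι → Type
  measurableSpace_D : ∀ j, MeasurableSpace (D j)
  law : ∀ j, Measure (D j)
  isProbabilityMeasure_law : ∀ j, IsProbabilityMeasure (law j)
  exo : V → Set ι
  f : ∀ v, (∀ w : {w // G.dir w v}, Ω w) → (∀ j : exo v, D j) → Ω v
  measurable_f : ∀ v pa a, MeasurableSet {e | f v pa e = a}
  share_iff : ∀ v w, v ≠ w → (G.bidir.Adj v w ↔ (exo v ∩ exo w).Nonempty)

namespace SCM

variable {V : Type*} {G : CausalDiagram V} {Y : V}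

attribute [instance] SCM.fintype_ι SCM.measurableSpace_D SCM.isProbabilityMeasure_law
  SCM.finite_Ω SCM.nonempty_Ω

open Classical in
/-- The solution of the submodel `M_x` for the unit `u`.  Of the assignment `x` only the
coordinates in `X` are used, so that `x` stands for the element `x[X]` of `Ω_X`. -/
noncomputable def response [Finite V] (M : SCM G Y) (X : Set V) (x : ∀ v, M.Ω v)
    (u : ∀ j, M.D j) : ∀ v, M.Ω v :=
  G.wellFounded_dir.fix fun v rec =>
    if v ∈ X then x v else M.f v (fun w => rec w.1 w.2) (fun j => u j.1)

open Classical in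
theorem response_eq [Finite V] (M : SCM G Y) (X : Set V) (x : ∀ v, M.Ω v)
    (u : ∀ j, M.D j) (v : V) :
    M.response X x u v =
      if v ∈ X then x v else M.f v (fun w => M.response X x u w.1) (fun j => u j.1) :=
  G.wellFounded_dir.fix_eq _ v

/-- The expected reward `E_{P_x} Y` under the intervention `do(X = x[X])`. -/
noncomputable def expReward [Finite V] (M : SCM G Y) (X : Set V) (x : ∀ v, M.Ω v) : ℝ :=
  ∫ u, M.val (M.response X x u Y) ∂(Measure.pi M.law)

/-- The reward `E_{P_{x*}} Y` of a best intervention on `X`: a maximum, since there are only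
finitely many assignments. -/
noncomputable def optReward [Finite V] (M : SCM G Y) (X : Set V) : ℝ :=
  ⨆ x : ∀ v, M.Ω v, M.expReward X x

end SCM

namespace CausalDiagram

variable {V : Type*} [Finite V]

/-- `X` and `X'` are equivalent intervention sets: in every SCM conforming to `G`, setting `X` and
setting `X'` according to one and the same assignment give the same expected reward.  For
`X' ⊆ X` this says that `E_{P_x} Y = E_{P_{x[X']}} Y` for all `x` in `Ω_X`. -/
def EquivIS (G : CausalDiagram V) (Y : V) (X X' : Set V) : Prop :=
  ∀ (M : SCM G Y) (x : ∀ v, M.Ω v), M.expReward X x = M.expReward X' x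

/-- Minimal intervention set. -/
def IsMIS (G : CausalDiagram V) (Y : V) (X : Set V) : Prop :=
  Y ∉ X ∧ ¬ ∃ X', X' ⊂ X ∧ G.EquivIS Y X X'

/-- Possibly-optimal minimal intervention set: an MIS that in some SCM conforming to `G` is
strictly better than all other MISs. -/
def IsPOMIS (G : CausalDiagram V) (Y : V) (X : Set V) : Prop :=
  G.IsMIS Y X ∧ ∃ M : SCM G Y, ∀ W, G.IsMIS Y W → W ≠ X → M.optReward W < M.optReward X

/-- Possibly-optimal intervention set: an intervention set that in some SCM conforming to `G` is
strictly better than all intervention sets that are not equivalent to it. -/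
def IsPOIS (G : CausalDiagram V) (Y : V) (X : Set V) : Prop :=
  Y ∉ X ∧ ∃ M : SCM G Y, ∀ W, Y ∉ W → ¬ G.EquivIS Y X W → M.optReward W < M.optReward X

end CausalDiagram

/-! Let `T` be the MUCT of `G.removeIncoming X` and `B` its border, the parents of `T` outside `T`.

Upper bound: `T` is closed under directed and bidirected edges among the ancestors of `Y` in
`G.removeIncoming X`, so under do(`X`) the border values do not depend on the noise of `T`. The
expected reward is therefore an average of rewards of interventions on `X ∪ B`, which gives
`optReward_le_optReward_union_ib`.

Lower bound: of `T` only `IsGenerated` is kept, a property in terms of `G` alone. In `recordSCM`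
fair bits are handed along directed paths inside `T`, and every vertex of `T` checks that what it
sees is consistent. With `B` set to blank records all checks in `T` succeed; if `W` meets `T` or
misses a vertex of `B`, the check at `Y` fails with positive probability
(`exists_response_eq_none`). All remaining `W` are disjoint from `T` and contain `B`, hence are
equivalent to `B`. This yields the POIS and POMIS claims.

Conversely, for a POIS `X` the upper bound forces `X` to be equivalent to `X ∪ B`, hence to `B`, and
`recordSCM` refutes this unless `B ⊆ X`. -/

namespace CausalDiagram

/-! ### Generated sets and territories -/

variable {V : Type*}

/-- `T` is generated by `Y`: every member of `T` is an ancestor of `Y` inside `T`, and `T` is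
exhausted by starting at `Y` and following outgoing directed and bidirected edges inside `T`. -/
structure IsGenerated (G : CausalDiagram V) (Y : V) (T : Set V) : Prop where
  mem : Y ∈ T
  reach : ∀ t ∈ T, Relation.ReflTransGen (G.induce T).dir t Y
  exhaust : ∀ A : Set V, Y ∈ A →
    (∀ a ∈ A, a ∈ T → ∀ t ∈ T, G.dir a t ∨ G.bidir.Adj a t → t ∈ A) → T ⊆ A

theorem isUCTerritory_of_closed {G : CausalDiagram V} {Y : V} {T : Set V} (hY : Y ∈ T)
    (hT : T ⊆ G.An {Y})
    (hcl : ∀ a ∈ T, ∀ t ∈ G.An {Y}, G.dir a t ∨ G.bidir.Adj a t → t ∈ T) :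
    G.IsUCTerritory Y T := by
  refine ⟨hY, hT, ?_, ?_⟩
  · refine subset_antisymm ?_ fun v hv => ⟨v, hv, .refl⟩
    rintro v ⟨s, hs, h⟩
    induction h with
    | refl => exact hs
    | tail _ h ih => exact hcl _ ih _ h.2.1 (.inl h.2.2)
  · refine subset_antisymm ?_ fun v hv => ⟨v, hv, .refl v⟩
    rintro v ⟨s, hs, ⟨p⟩⟩
    induction p with
    | nil => exact hs
    | cons h _ ih => exact ih (hcl _ hs _ h.2.1 (.inr h.2.2))

theorem mem_muct_of_edge {G : CausalDiagram V} {Y a t : V} (ha : a ∈ G.MUCT Y)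
    (ht : t ∈ G.An {Y}) (h : G.dir a t ∨ G.bidir.Adj a t) : t ∈ G.MUCT Y := by
  obtain ⟨-, hsub, hDe, hCC⟩ := G.isUCTerritory_muct Y
  rcases h with h | h
  · rw [← hDe]
    exact ⟨a, ha, .single ⟨hsub ha, ht, h⟩⟩
  · rw [← hCC]
    exact ⟨a, ha, SimpleGraph.Adj.reachable ⟨hsub ha, ht, h⟩⟩

theorem isGenerated_muct (G : CausalDiagram V) (Y : V) : G.IsGenerated Y (G.MUCT Y) := by
  obtain ⟨hY, hsub, -, -⟩ := G.isUCTerritory_muct Y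
  refine ⟨hY, fun t ht => ?_, fun A hA hcl => ?_⟩
  · obtain ⟨s, rfl, h⟩ := hsub ht
    induction h using Relation.ReflTransGen.head_induction_on with
    | refl => exact .refl
    | head hac hcs ih =>
      have hc := mem_muct_of_edge ht ⟨s, rfl, hcs⟩ (.inl hac)
      exact .head ⟨ht, hc, hac⟩ (ih hc)
  -- The part of the MUCT inside `A` is again a territory, so by minimality it is everything.
  · have : G.IsUCTerritory Y (A ∩ G.MUCT Y) :=
      isUCTerritory_of_closed ⟨hA, hY⟩ (Set.inter_subset_right.trans hsub)
        fun a ha t ht h =>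
          have := mem_muct_of_edge ha.2 ht h
          ⟨hcl a ha.1 ha.2 t this h, this⟩
    exact (Set.sInter_subset_of_mem this).trans Set.inter_subset_left

/-- No edge of `G.removeIncoming X` enters `X`, so the exploration from `Y` never leaves `Xᶜ`. -/
theorem notMem_of_mem_muct_removeIncoming {G : CausalDiagram V} {Y t : V} {X : Set V}
    (hX : Y ∉ X) (ht : t ∈ (G.removeIncoming X).MUCT Y) : t ∉ X :=
  ((G.removeIncoming X).isGenerated_muct Y).exhaust Xᶜ hX
    (fun _ _ _ _ _ h => h.elim (fun h => h.1) fun h => h.2.1) ht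

/-- Restoring edges only strengthens the closure assumption on `A`. In `G` the set `T` need not be a
territory any more, but it is still generated. -/
theorem IsGenerated.of_removeIncoming {G : CausalDiagram V} {Y : V} {X T : Set V}
    (h : (G.removeIncoming X).IsGenerated Y T) : G.IsGenerated Y T where
  mem := h.mem
  reach t ht := 
    Relation.ReflTransGen.mono (fun _ _ h => ⟨h.1, h.2.1, h.2.2.2⟩) _ _ (h.reach t ht)
  exhaust A hA hcl := h.exhaust A hA fun a ha haT t ht hat =>
    hcl a ha haT t ht (hat.imp (fun h => h.2) fun h => h.2.2)

theorem isGenerated_muct_removeIncoming (G : CausalDiagram V) (Y : V) (X : Set V) :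
    G.IsGenerated Y ((G.removeIncoming X).MUCT Y) :=
  ((G.removeIncoming X).isGenerated_muct Y).of_removeIncoming

theorem ib_removeIncoming (G : CausalDiagram V) {Y : V} {X : Set V} (hX : Y ∉ X) :
    (G.removeIncoming X).IB Y =
      G.Pa ((G.removeIncoming X).MUCT Y) \ (G.removeIncoming X).MUCT Y := by
  ext v
  constructor
  · rintro ⟨⟨s, hs, h⟩, hv⟩
    exact ⟨⟨s, hs, h.2⟩, hv⟩
  · rintro ⟨⟨s, hs, h⟩, hv⟩
    exact ⟨⟨s, hs, notMem_of_mem_muct_removeIncoming hX hs, h⟩, hv⟩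

end CausalDiagram

/-! ### Responses: dependence on the border, measurability -/

namespace SCM

open CausalDiagram

variable {V : Type*} [Finite V] {G : CausalDiagram V} {Y : V}

theorem response_of_mem (M : SCM G Y) {X : Set V} {v : V} (hv : v ∈ X) (x : ∀ v, M.Ω v)
    (u : ∀ j, M.D j) : M.response X x u v = x v := by
  rw [response_eq, if_pos hv]

theorem response_of_notMem (M : SCM G Y) {X : Set V} {v : V} (hv : v ∉ X) (x : ∀ v, M.Ω v)
    (u : ∀ j, M.D j) :
    M.response X x u v = M.f v (fun w => M.response X x u w.1) (fun j => u j.1) := by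
  rw [response_eq, if_neg hv]

/-- Border values and own noise are the only inputs of `T`. The two sides may differ in
intervention, assignment and noise, so that border values arising under one can be imposed in the
other. -/
theorem response_congr_of_border (M : SCM G Y) {T X W : Set V} (hX : ∀ t ∈ T, t ∉ X)
    (hW : ∀ t ∈ T, t ∉ W) {x x' : ∀ v, M.Ω v} {u u' : ∀ j, M.D j}
    (hu : ∀ t ∈ T, ∀ j ∈ M.exo t, u j = u' j)
    (hb : ∀ b ∈ G.Pa T \ T, M.response X x u b = M.response W x' u' b) :
    ∀ t ∈ T, M.response X x u t = M.response W x' u' t := by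
  intro t
  induction t using G.wellFounded_dir.induction with
  | _ t ih =>
    intro ht
    rw [M.response_of_notMem (hX t ht), M.response_of_notMem (hW t ht)]
    congr 1
    · funext p
      by_cases hp : p.1 ∈ T
      · exact ih _ p.2 hp
      · exact hb _ ⟨⟨t, ht, p.2⟩, hp⟩
    · funext j
      exact hu t ht j j.2

theorem measurableSet_response_eq (M : SCM G Y) (X : Set V) (x : ∀ v, M.Ω v) (v : V)
    (a : M.Ω v) : MeasurableSet {u | M.response X x u v = a} := by
  induction v using G.wellFounded_dir.induction with
  | _ v ih =>
    by_cases hv : v ∈ X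
    · simp only [M.response_of_mem hv, MeasurableSet.const]
    -- Split according to the finitely many values of the parents.
    · have : {u | M.response X x u v = a} = ⋃ pa : ∀ w : {w // G.dir w v}, M.Ω w,
          (⋂ w, {u | M.response X x u w.1 = pa w}) ∩
            (fun (u : ∀ j, M.D j) (j : M.exo v) => u j.1) ⁻¹' {e | M.f v pa e = a} := by
        ext u
        simp only [M.response_of_notMem hv, Set.mem_ofPred_eq, Set.mem_iUnion, Set.mem_inter_iff,
          Set.mem_iInter, Set.mem_preimage]
        constructor
        · exact fun h => ⟨_, fun _ => rfl, h⟩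
        · rintro ⟨pa, h, rfl⟩
          rw [← show (fun w : {w // G.dir w v} => M.response X x u w.1) = pa from funext h]
      rw [this]
      refine .iUnion fun pa => .inter (.iInter fun w => ih _ w.2 _) ?_
      exact (measurable_pi_lambda _ fun j => measurable_pi_apply j.1) (M.measurable_f v pa a)

theorem measurable_reward (M : SCM G Y) (X : Set V) (x : ∀ v, M.Ω v) :
    Measurable fun u => M.val (M.response X x u Y) := by
  let _ : MeasurableSpace (M.Ω Y) := ⊤
  exact (measurable_from_top (f := M.val)).comp
    (measurable_to_countable' fun a => M.measurableSet_response_eq X x Y a)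

omit [Finite V] in
theorem exists_norm_val_le (M : SCM G Y) : ∃ C, ∀ a, ‖M.val a‖ ≤ C := by
  obtain ⟨C, hC⟩ := (Set.finite_range fun a => ‖M.val a‖).bddAbove
  exact ⟨C, fun a => hC ⟨a, rfl⟩⟩

theorem bddAbove_expReward (M : SCM G Y) (X : Set V) :
    BddAbove (Set.range fun x => M.expReward X x) :=
  (Set.finite_range _).bddAbove

theorem expReward_le_optReward (M : SCM G Y) (X : Set V) (x : ∀ v, M.Ω v) :
    M.expReward X x ≤ M.optReward X :=
  le_ciSup (M.bddAbove_expReward X) x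

theorem exists_expReward_eq_optReward (M : SCM G Y) (X : Set V) :
    ∃ x, M.expReward X x = M.optReward X := by
  have : Nonempty (∀ v, M.Ω v) := inferInstance
  exact exists_eq_ciSup_of_finite

end SCM

/-! ### Upper bound: adding the border to an intervention -/

open Classical in
/-- Resampling the coordinates outside `S` preserves a product measure. -/
theorem measurePreserving_piecewise_pi {ι : Type*} [Fintype ι] {D : ι → Type*}
    [∀ j, MeasurableSpace (D j)] (μ : ∀ j, Measure (D j)) [∀ j, IsProbabilityMeasure (μ j)]
    (S : Set ι) :
    MeasurePreserving (fun p : (∀ j, D j) × (∀ j, D j) => S.piecewise p.1 p.2)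
      ((Measure.pi μ).prod (Measure.pi μ)) (Measure.pi μ) := by
  have hm : Measurable fun p : (∀ j, D j) × (∀ j, D j) => S.piecewise p.1 p.2 := by
    refine measurable_pi_lambda _ fun j => ?_
    by_cases hj : j ∈ S
    · simp only [Set.piecewise_eq_of_mem _ _ _ hj]
      fun_prop
    · simp only [Set.piecewise_eq_of_notMem _ _ _ hj]
      fun_prop
  refine ⟨hm, (Measure.pi_eq fun s hs => ?_).symm⟩
  rw [Measure.map_apply hm (.univ_pi hs)]
  have : (fun p : (∀ j, D j) × (∀ j, D j) => S.piecewise p.1 p.2) ⁻¹' Set.univ.pi s =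
      (Set.univ.pi fun j => if j ∈ S then s j else Set.univ) ×ˢ
        (Set.univ.pi fun j => if j ∈ S then Set.univ else s j) := by
    ext p
    simp only [Set.mem_preimage, Set.mem_pi, Set.mem_univ, true_implies, Set.mem_prod,
      ← forall_and]
    refine forall_congr' fun j => ?_
    by_cases hj : j ∈ S <;> simp [hj]
  rw [this, Measure.prod_prod, Measure.pi_pi, Measure.pi_pi, ← Finset.prod_mul_distrib]
  refine Finset.prod_congr rfl fun j _ => ?_
  by_cases hj : j ∈ S <;> simp [hj]

namespace SCM

open CausalDiagram

variable {V : Type*} [Finite V] {G : CausalDiagram V} {Y : V}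

theorem expReward_congr_of_border (M : SCM G Y) {T X : Set V} (hY : Y ∈ T)
    (hX : ∀ t ∈ T, t ∉ X) (hB : G.Pa T \ T ⊆ X) (x : ∀ v, M.Ω v) :
    M.expReward X x = M.expReward (G.Pa T \ T) x := by
  unfold expReward
  congr 1 with u
  congr 1
  refine M.response_congr_of_border hX (fun t ht h => h.2 ht) (fun _ _ _ _ => rfl)
    (fun b hb => ?_) Y hY
  rw [M.response_of_mem (hB hb), M.response_of_mem hb]

/-- Outside the territory the submodel does not depend on the noise of the territory. -/
theorem response_congr_of_notMem_muct (M : SCM G Y) {X : Set V} (hX : Y ∉ X) (x : ∀ v, M.Ω v)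
    {u u' : ∀ j, M.D j}
    (hu : ∀ j, (∀ t ∈ (G.removeIncoming X).MUCT Y, j ∉ M.exo t) → u j = u' j) :
    ∀ v ∈ (G.removeIncoming X).An {Y}, v ∉ (G.removeIncoming X).MUCT Y →
      M.response X x u v = M.response X x u' v := by
  intro v
  induction v using G.wellFounded_dir.induction with
  | _ v ih =>
    intro hv hvT
    by_cases hvX : v ∈ X
    · rw [M.response_of_mem hvX, M.response_of_mem hvX]
    rw [M.response_of_notMem hvX, M.response_of_notMem hvX]
    congr 1
    · funext p
      -- A parent in the territory, or noise shared with it, would pull `v` into the territory.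
      refine ih _ p.2 ?_ fun hp => hvT (mem_muct_of_edge hp hv (.inl ⟨hvX, p.2⟩))
      obtain ⟨s, hs, h⟩ := hv
      exact ⟨s, hs, .head ⟨hvX, p.2⟩ h⟩
    · funext j
      refine hu j fun t ht hj => hvT (mem_muct_of_edge ht hv (.inr ?_))
      refine ⟨notMem_of_mem_muct_removeIncoming hX ht, hvX, ?_⟩
      rw [M.share_iff _ _ (ne_of_mem_of_not_mem ht hvT)]
      exact ⟨j, hj, j.2⟩

open Classical in
/-- Additionally intervening on the interventional border never lowers the optimal reward. -/
theorem optReward_le_optReward_union_ib (M : SCM G Y) {X : Set V} (hX : Y ∉ X) :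
    M.optReward X ≤ M.optReward (X ∪ (G.removeIncoming X).IB Y) := by
  have : Nonempty (∀ v, M.Ω v) := inferInstance
  refine ciSup_le fun x => ?_
  set T := (G.removeIncoming X).MUCT Y with hTdef
  set W := X ∪ (G.removeIncoming X).IB Y with hW
  have hTX : ∀ t ∈ T, t ∉ X := fun t ht => notMem_of_mem_muct_removeIncoming hX ht
  obtain ⟨hYT, hTA, -, -⟩ := (G.removeIncoming X).isUCTerritory_muct Y
  let S : Set M.ι := {j | ∃ t ∈ T, j ∈ M.exo t}
  -- Here `u` drives `T` and `u'` drives the border, so the border values for `u'` can be set by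
  -- intervention.
  have key : ∀ u u', M.response X x (S.piecewise u u') Y =
      M.response W (M.response X x u') u Y := by
    intro u u'
    refine M.response_congr_of_border hTX ?_ ?_ ?_ Y hYT
    · rintro t ht (h | h)
      exacts [hTX t ht h, h.2 ht]
    · exact fun t ht j hj => Set.piecewise_eq_of_mem _ _ _ ⟨t, ht, hj⟩
    · intro b hb
      rw [M.response_of_mem (X := W) (.inr (by rwa [ib_removeIncoming G hX]))]
      refine M.response_congr_of_notMem_muct hX x (fun j hj => ?_) b ?_ hb.2
      · refine Set.piecewise_eq_of_notMem _ _ _ ?_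
        rintro ⟨t, ht, h⟩
        exact hj t ht h
      · obtain ⟨⟨t, ht, h⟩, -⟩ := hb
        obtain ⟨s, hs, h'⟩ := hTA ht
        exact ⟨s, hs, .head ⟨hTX t ht, h⟩ h'⟩
  have hmp := measurePreserving_piecewise_pi M.law S
  obtain ⟨C, hC⟩ := M.exists_norm_val_le
  have hF : AEStronglyMeasurable (fun u => M.val (M.response X x u Y)) (Measure.pi M.law) :=
    (M.measurable_reward X x).aestronglyMeasurable
  have hint : Integrable (fun p : (∀ j, M.D j) × (∀ j, M.D j) =>
      M.val (M.response X x (S.piecewise p.1 p.2) Y))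
      ((Measure.pi M.law).prod (Measure.pi M.law)) :=
    .of_bound (hF.comp_measurePreserving hmp) C (.of_forall fun _ => hC _)
  -- By Fubini, do(`X`) is do(`W`) with a random assignment independent of `u`.
  have h1 : M.expReward X x = ∫ u', M.expReward W (M.response X x u') ∂(Measure.pi M.law) := by
    unfold expReward
    rw [← hmp.map_eq, integral_map hmp.measurable.aemeasurable (by rwa [hmp.map_eq]),
      integral_prod_symm _ hint, hmp.map_eq]
    simp only [key]
  have h2 : Integrable (fun u' => M.expReward W (M.response X x u')) (Measure.pi M.law) := by
    have := hint.integral_prod_right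
    simp only [key] at this
    exact this
  rw [h1]
  calc _ ≤ ∫ _, M.optReward W ∂(Measure.pi M.law) :=
        integral_mono h2 (integrable_const _) fun u' => M.expReward_le_optReward W _
    _ = _ := by simp

end SCM

/-! ### Lower bound: the record-passing model -/

/-- Finitely many noise variables can be assigned to the vertices of `H`, some to each, so that
exactly the adjacent vertices share one. -/
theorem SimpleGraph.exists_shared_index {V : Type*} [Finite V] (H : SimpleGraph V) :
    ∃ (ι : Type) (_ : Fintype ι) (exo : V → Set ι), (∀ v, (exo v).Nonempty) ∧
      ∀ v w, v ≠ w → (H.Adj v w ↔ (exo v ∩ exo w).Nonempty) := by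
  obtain ⟨n, ⟨e⟩⟩ := Finite.exists_equiv_fin V
  -- Diagonal pairs serve as private noise and make each `exo v` nonempty; adjacent pairs serve as
  -- shared noise.
  refine ⟨Fin n × Fin n, inferInstance, fun v => {p | (p.1 = e v ∨ p.2 = e v) ∧
    (p.1 = p.2 ∨ H.Adj (e.symm p.1) (e.symm p.2))}, fun v => ⟨(e v, e v), by simp⟩,
    fun v w hvw => ⟨fun h => ⟨(e v, e w), by simp [h]⟩, ?_⟩⟩
  rintro ⟨⟨a, b⟩, ⟨hv, h⟩, hw, -⟩
  obtain ⟨a, rfl⟩ := e.surjective a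
  obtain ⟨b, rfl⟩ := e.surjective b
  simp only [EmbeddingLike.apply_eq_iff_eq, Equiv.symm_apply_apply] at hv hw h
  rcases hv with rfl | rfl <;> rcases hw with rfl | rfl
  · exact absurd rfl hvw
  · exact h.resolve_left hvw
  · exact (h.resolve_left hvw.symm).symm
  · exact absurd rfl hvw

namespace CausalDiagram

variable {V : Type*} {ι : Type}

/-- The noise variables known to a vertex `v` of `T`: those of its ancestors inside `T`.  The
vertex `Y` keeps its knowledge to itself. -/
def knownNoise (G : CausalDiagram V) (Y : V) (T : Set V) (exo : V → Set ι) (v : V) : Set ι :=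
  {j | v ≠ Y ∧ v ∈ T ∧ ∃ a, Relation.ReflTransGen (G.induce T).dir a v ∧ j ∈ exo a}

open Classical in
/-- The record that a vertex passes on: the noise known to it, and `false` elsewhere. -/
noncomputable def record (G : CausalDiagram V) (Y : V) (T : Set V) (exo : V → Set ι) (v : V)
    (u : ι → Bool) : ι → Bool :=
  fun j => if j ∈ G.knownNoise Y T exo v then u j else false

section record

variable {G : CausalDiagram V} {Y : V} {T : Set V} {exo : V → Set ι}

theorem record_eq_iff {v : V} {u u' : ι → Bool} :
    G.record Y T exo v u = G.record Y T exo v u' ↔ ∀ j ∈ G.knownNoise Y T exo v, u j = u' j := by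
  simp only [funext_iff, record]
  refine forall_congr' fun j => ?_
  by_cases h : j ∈ G.knownNoise Y T exo v <;> simp [h]

/-- Thus the reward after a successful check at `Y` is constant. -/
theorem record_self (u : ι → Bool) : G.record Y T exo Y u = fun _ => false := by
  funext j
  exact if_neg fun h => h.1 rfl

theorem record_of_notMem {v : V} (hv : v ∉ T) (u : ι → Bool) :
    G.record Y T exo v u = fun _ => false := by
  funext j
  exact if_neg fun h => hv h.2.1

theorem knownNoise_mono {p c : V} (hp : p ∈ T) (hc : c ∈ T) (h : G.dir p c) (hcY : c ≠ Y) :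
    G.knownNoise Y T exo p ⊆ G.knownNoise Y T exo c := by
  rintro j ⟨-, -, a, hap, hj⟩
  exact ⟨hcY, hc, a, hap.tail ⟨hp, hc, h⟩, hj⟩

theorem exo_subset_knownNoise {a : V} (ha : a ∈ T) (haY : a ≠ Y) :
    exo a ⊆ G.knownNoise Y T exo a :=
  fun _ hj => ⟨haY, ha, a, .refl, hj⟩

theorem IsGenerated.not_dir (hT : G.IsGenerated Y T) {t : V} (ht : t ∈ T) : ¬ G.dir Y t :=
  fun h => G.acyclic Y <| .head' h <|
    Relation.ReflTransGen.mono (fun _ _ h => h.2.2) _ _ (hT.reach t ht)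

/-- Hence own noise and the parents' records determine the record of `v`, and the choice of `u'` in
`recordSCM` is immaterial. -/
theorem IsGenerated.mem_exo_or_exists_parent (hT : G.IsGenerated Y T) {v : V} {j : ι}
    (hj : j ∈ G.knownNoise Y T exo v) :
    j ∈ exo v ∨ ∃ p, G.dir p v ∧ j ∈ G.knownNoise Y T exo p := by
  obtain ⟨-, hv, a, hav, hj⟩ := hj
  rcases hav.cases_tail with rfl | ⟨p, hap, hpv⟩
  · exact .inl hj
  · refine .inr ⟨p, hpv.2.2, ?_, hpv.1, a, hap, hj⟩
    rintro rfl
    exact hT.not_dir hv hpv.2.2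

end record

open Classical in
/-- The SCM in which every vertex of `T` checks that the records of all its parents agree with
one another and with its own noise, and passes on its record, or `none` after a failed check. -/
noncomputable def recordSCM [Fintype ι] (G : CausalDiagram V) (Y : V) (T : Set V)
    (exo : V → Set ι)
    (hexo : ∀ v w, v ≠ w → (G.bidir.Adj v w ↔ (exo v ∩ exo w).Nonempty)) : SCM G Y where
  Ω _ := Option (ι → Bool)
  finite_Ω _ := inferInstance
  nonempty_Ω _ := inferInstance
  val a :=
    letI := Encodable.ofCountable (ι → Bool)
    (Encodable.encode a : ℝ)
  val_injective a b h := by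
    let _ := Encodable.ofCountable (ι → Bool)
    exact Encodable.encode_injective (Nat.cast_injective h)
  ι := ι
  fintype_ι := inferInstance
  D _ := Bool
  measurableSpace_D _ := inferInstance
  law _ := (PMF.uniformOfFintype Bool).toMeasure
  isProbabilityMeasure_law _ := inferInstance
  exo := exo
  f v pa u :=
    if h : v ∈ T ∧ ∃ u' : ι → Bool, (∀ j : exo v, u' j = u j) ∧
        ∀ p, pa p = some (G.record Y T exo p.1 u') then
      some (G.record Y T exo v h.2.choose)
    else none
  measurable_f _ _ _ := (Set.toFinite _).measurableSet
  share_iff := hexo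

/-! ### Success and failure of the checks -/

section recordSCM

variable [Fintype ι] [Finite V] {G : CausalDiagram V} {Y : V} {T : Set V} {exo : V → Set ι}
  (hexo : ∀ v w, v ≠ w → (G.bidir.Adj v w ↔ (exo v ∩ exo w).Nonempty))

omit [Finite V] in
theorem recordSCM_val_none : (G.recordSCM Y T exo hexo).val none = 0 := by
  let _ := Encodable.ofCountable (ι → Bool)
  exact (congrArg Nat.cast Encodable.encode_none).trans Nat.cast_zero

omit [Finite V] in
theorem recordSCM_val_some_pos (r : ι → Bool) : 0 < (G.recordSCM Y T exo hexo).val (some r) := by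
  let _ := Encodable.ofCountable (ι → Bool)
  refine (Nat.cast_pos (α := ℝ)).2 ?_
  rw [Encodable.encode_some]
  exact Nat.succ_pos _

theorem recordSCM_response {W : Set V} {v : V} (hv : v ∉ W) (x : V → Option (ι → Bool))
    (u : ι → Bool) :
    (∃ u', v ∈ T ∧ (∀ j ∈ exo v, u' j = u j) ∧
      (∀ p, G.dir p v →
        (G.recordSCM Y T exo hexo).response W x u p = some (G.record Y T exo p u')) ∧
      (G.recordSCM Y T exo hexo).response W x u v = some (G.record Y T exo v u')) ∨
    (G.recordSCM Y T exo hexo).response W x u v = none ∧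
      (v ∈ T → ∀ u', (∀ j ∈ exo v, u' j = u j) → ∃ p, G.dir p v ∧
        (G.recordSCM Y T exo hexo).response W x u p ≠ some (G.record Y T exo p u')) := by
  have heq := (G.recordSCM Y T exo hexo).response_of_notMem hv x u
  by_cases h : v ∈ T ∧ ∃ u' : ι → Bool, (∀ j : exo v, u' j = u j) ∧
      ∀ p : {w // G.dir w v}, (G.recordSCM Y T exo hexo).response W x u p.1 =
        some (G.record Y T exo p.1 u')
  · exact .inl ⟨h.2.choose, h.1, fun j hj => h.2.choose_spec.1 ⟨j, hj⟩,
      fun p hp => h.2.choose_spec.2 ⟨p, hp⟩, heq.trans (dif_pos h)⟩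
  · refine .inr ⟨heq.trans (dif_neg h), fun hvT u' hu' => ?_⟩
    by_contra! hc
    exact h ⟨hvT, u', fun j => hu' j j.2, fun p => hc p p.2⟩

/-- Nothing fails if the border of `T` is set correctly and `T` is left alone. -/
theorem IsGenerated.recordSCM_response_of_mem (hT : G.IsGenerated Y T) (u : ι → Bool) {v : V}
    (hv : v ∈ T) :
    (G.recordSCM Y T exo hexo).response (G.Pa T \ T) (fun _ => some fun _ => false) u v =
      some (G.record Y T exo v u) := by
  induction v using G.wellFounded_dir.induction with
  | _ v ih =>
    have hp : ∀ p, G.dir p v → (G.recordSCM Y T exo hexo).response (G.Pa T \ T)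
        (fun _ => some fun _ => false) u p = some (G.record Y T exo p u) := by
      intro p hpv
      by_cases hpT : p ∈ T
      · exact ih p hpv hpT
      · rw [record_of_notMem hpT]
        exact SCM.response_of_mem _ (X := G.Pa T \ T) ⟨⟨v, hv, hpv⟩, hpT⟩ _ _
    obtain ⟨u', -, hu', hp', h⟩ | ⟨-, h⟩ :=
      recordSCM_response (Y := Y) (T := T) hexo (W := G.Pa T \ T) (fun h => h.2 hv)
        (fun _ => some fun _ => false) u
    · rw [h]
      congr 1
      refine record_eq_iff.2 fun j hj => ?_
      obtain hj | ⟨p, hpv, hj⟩ := hT.mem_exo_or_exists_parent hj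
      · exact hu' j hj
      · have := (hp' p hpv).symm.trans (hp p hpv)
        exact record_eq_iff.1 (Option.some_injective _ this) j hj
    · obtain ⟨p, hpv, h⟩ := h hv u fun _ _ => rfl
      exact absurd (hp p hpv) h

/-- The vertices from which `Y` can be reached inside `T` without meeting `W`. -/
def openTo (G : CausalDiagram V) (Y : V) (T W : Set V) : Set V :=
  {a | Relation.ReflTransGen (G.induce (T \ W)).dir a Y}

/-- If no check fails, the records seen along open paths come from a single noise vector. -/
theorem exists_noise_of_response_ne_none {W : Set V} (hY : Y ∉ W)
    {x : V → Option (ι → Bool)} {u : ι → Bool}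
    (h : (G.recordSCM Y T exo hexo).response W x u Y ≠ none) :
    ∃ u' : ι → Bool, ∀ a ∈ G.openTo Y T W, (∀ j ∈ exo a, u' j = u j) ∧
      ∀ p, G.dir p a →
        (G.recordSCM Y T exo hexo).response W x u p = some (G.record Y T exo p u') := by
  obtain ⟨u', -, hu', hp', -⟩ | h' :=
    recordSCM_response (T := T) hexo hY x u
  swap
  · exact absurd h'.1 h
  refine ⟨u', fun a ha => ?_⟩
  induction ha using Relation.ReflTransGen.head_induction_on with
  | refl => exact ⟨hu', hp'⟩
  | @head a c hac hcY ih =>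
    have ha := ih.2 a hac.2.2
    obtain ⟨w, haT, hw, hpw, hw'⟩ | h' :=
      recordSCM_response (Y := Y) (T := T) hexo hac.1.2 x u
    swap
    · rw [h'.1] at ha
      cases ha
    by_cases haY : a = Y
    · subst haY
      exact ⟨hu', hp'⟩
    -- The child saw the record of `a` for `u'`, so the witness `w` at `a` agrees with `u'` on all
    -- noise known to `a`, which includes its own noise and that known to its parents.
    have heq := record_eq_iff.1 (Option.some_injective _ (ha.symm.trans hw'))
    refine ⟨fun j hj => (heq j (exo_subset_knownNoise haT haY hj)).trans (hw j hj),
      fun p hpa => ?_⟩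
    rw [hpw p hpa]
    congr 1
    refine record_eq_iff.2 fun j hj => (heq j ?_).symm
    exact knownNoise_mono hj.2.1 haT hpa haY hj

/-- The check at `Y` can fail if some vertex of `T` is fixed or some vertex of the border of `T` is
not. -/
theorem IsGenerated.exists_response_eq_none (hT : G.IsGenerated Y T)
    (hne : ∀ v, (exo v).Nonempty) {W : Set V} (hY : Y ∉ W)
    (hW : (W ∩ T).Nonempty ∨ ¬ G.Pa T \ T ⊆ W) (x : V → Option (ι → Bool)) :
    ∃ u : ι → Bool, (G.recordSCM Y T exo hexo).response W x u Y = none := by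
  classical
  by_contra! hall
  have hYA : Y ∈ G.openTo Y T W := Relation.ReflTransGen.refl
  have hA : ∀ {p a}, a ∈ G.openTo Y T W → a ∈ T → a ∉ W → p ∈ T → p ∉ W → G.dir p a →
      p ∈ G.openTo Y T W := fun ha haT haW hpT hpW hpa => .head ⟨⟨hpT, hpW⟩, ⟨haT, haW⟩, hpa⟩ ha
  have hAT : ∀ {a}, a ∈ G.openTo Y T W → a ∈ T ∧ a ∉ W := by
    intro a ha
    rcases ha.cases_head with rfl | ⟨c, h, -⟩
    exacts [⟨hT.mem, hY⟩, h.1]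
  by_cases hTA : T ⊆ G.openTo Y T W
  -- All of `T` is open, so `W` avoids `T` and leaves a border vertex `b` free; lying outside `T`,
  -- it reports `none`.
  · obtain ⟨b, hb, hbW⟩ := Set.not_subset.1 <| hW.resolve_left fun ⟨w, hw, hwT⟩ =>
      (hAT (hTA hwT)).2 hw
    obtain ⟨⟨t, ht, hbt⟩, hbT⟩ := hb
    obtain ⟨u', hu'⟩ := exists_noise_of_response_ne_none hexo hY (hall fun _ => false)
    have hb := (hu' t (hTA ht)).2 b hbt
    obtain ⟨_, h, -⟩ | h := recordSCM_response (Y := Y) (T := T) hexo hbW x fun _ => false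
    · exact hbT h
    · rw [h.1] at hb
      cases hb
  · -- some noise seen by an open vertex also reaches a vertex that is not open
    obtain ⟨j, ⟨a, ha, hja⟩, t, htT, htA, hjt⟩ : ∃ j, (∃ a ∈ G.openTo Y T W, j ∈ exo a) ∧
        ∃ t ∈ T, t ∉ G.openTo Y T W ∧ j ∈ G.knownNoise Y T exo t := by
      by_contra! hno
      refine hTA (hT.exhaust _ hYA fun a ha haT t ht hat => ?_)
      by_contra htA
      have htY : t ≠ Y := fun h => htA (h ▸ hYA)
      rcases hat with hat | hat
      · obtain ⟨j, hj⟩ := hne a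
        exact hno j ⟨a, ha, hj⟩ t ht htA ⟨htY, ht, a, .single ⟨haT, ht, hat⟩, hj⟩
      · obtain ⟨j, hj, hj'⟩ := (hexo a t (G.bidir.ne_of_adj hat)).1 hat
        exact hno j ⟨a, ha, hj⟩ t ht htA (exo_subset_knownNoise ht htY hj')
    -- it passes a vertex of `W` on its way to `Y`
    obtain ⟨w, hwW, c, hc, hwc, hjw⟩ : ∃ w ∈ W, ∃ c ∈ G.openTo Y T W, G.dir w c ∧
        j ∈ G.knownNoise Y T exo w := by
      have hreach := hT.reach t htT
      induction hreach using Relation.ReflTransGen.head_induction_on with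
      | refl => exact absurd hYA htA
      | @head t c htc hcY ih =>
        by_cases hcA : c ∈ G.openTo Y T W
        · refine ⟨t, ?_, c, hcA, htc.2.2, hjt⟩
          by_contra htW
          exact htA (hA hcA (hAT hcA).1 (hAT hcA).2 htT htW htc.2.2)
        · exact ih htc.2.1 hcA
            (knownNoise_mono htT htc.2.1 htc.2.2 (fun h => hcA (h ▸ hYA)) hjt)
    -- The constant set at `w` would have to show the true bit `j` for every noise vector, both for
    -- `false` and for `true`.
    have hval : ∀ u : ι → Bool, ∃ r, x w = some r ∧ r j = u j := by
      intro u
      obtain ⟨u', hu'⟩ := exists_noise_of_response_ne_none hexo hY (hall u)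
      have hxw : (G.recordSCM Y T exo hexo).response W x u w = x w :=
        (G.recordSCM Y T exo hexo).response_of_mem hwW x u
      refine ⟨_, hxw.symm.trans ((hu' c hc).2 w hwc), ?_⟩
      rw [← (hu' a ha).1 j hja]
      exact if_pos hjw
    obtain ⟨r, hr, h0⟩ := hval fun _ => false
    obtain ⟨r', hr', h1⟩ := hval fun _ => true
    obtain rfl := Option.some_injective _ (hr.symm.trans hr')
    exact Bool.false_ne_true (h0.symm.trans h1)

theorem IsGenerated.optReward_recordSCM_lt (hT : G.IsGenerated Y T)
    (hne : ∀ v, (exo v).Nonempty) {W : Set V} (hY : Y ∉ W)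
    (hW : (W ∩ T).Nonempty ∨ ¬ G.Pa T \ T ⊆ W) :
    (G.recordSCM Y T exo hexo).optReward W <
      (G.recordSCM Y T exo hexo).optReward (G.Pa T \ T) := by
  set M := G.recordSCM Y T exo hexo with hM
  set c := M.val (some fun _ => false) with hc
  have hc0 : 0 < c := recordSCM_val_some_pos hexo _
  have hB : c ≤ M.optReward (G.Pa T \ T) := by
    refine le_of_eq_of_le ?_ (M.expReward_le_optReward _ fun _ => some fun _ => false)
    have h : ∀ u : ∀ j, M.D j, M.response (G.Pa T \ T) (fun _ => some fun _ => false) u Y =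
        some fun _ => false := fun u =>
      (hT.recordSCM_response_of_mem hexo u hT.mem).trans (congrArg some (record_self _))
    simp only [SCM.expReward, h]
    simp [hc]
  refine lt_of_lt_of_le ?_ hB
  obtain ⟨x, hx⟩ := M.exists_expReward_eq_optReward W
  rw [← hx]
  obtain ⟨u₀, hu₀⟩ : ∃ u₀ : ∀ j, M.D j, M.response W x u₀ Y = none :=
    hT.exists_response_eq_none hexo hne hY hW x
  have hnn : ∀ u, 0 ≤ c - M.val (M.response W x u Y) := by
    intro u
    obtain ⟨u', -, -, -, h⟩ | ⟨h, -⟩ := recordSCM_response (T := T) hexo hY x u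
    · rw [h, record_self, ← hc, sub_self]
    · rw [h, recordSCM_val_none, sub_zero]
      exact hc0.le
  obtain ⟨C, hC⟩ := M.exists_norm_val_le
  have hint : Integrable (fun u => M.val (M.response W x u Y)) (Measure.pi M.law) :=
    .of_bound (M.measurable_reward W x).aestronglyMeasurable C (.of_forall fun _ => hC _)
  have hpos : 0 < ∫ u, (c - M.val (M.response W x u Y)) ∂(Measure.pi M.law) := by
    rw [integral_pos_iff_support_of_nonneg hnn ((integrable_const c).sub hint)]
    -- Fair bits give each noise vector positive mass, so one failing vector makes the gap strict.
    refine lt_of_lt_of_le ?_ (measure_mono (s := {u₀}) ?_)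
    · rw [Measure.pi_singleton]
      refine CanonicallyOrderedAdd.prod_pos.2 fun j _ => ?_
      have hbool : ∀ b : Bool, 0 < (PMF.uniformOfFintype Bool).toMeasure {b} := fun b => by
        rw [PMF.toMeasure_apply_singleton _ _ (measurableSet_singleton _)]
        simp
      exact hbool (u₀ j)
    · refine Set.singleton_subset_iff.2 ?_
      change c - M.val (M.response W x u₀ Y) ≠ 0
      rw [hu₀, recordSCM_val_none, sub_zero]
      exact hc0.ne'
  rw [integral_sub (integrable_const c) hint] at hpos
  simpa [SCM.expReward] using hpos

end recordSCM

/-! ### Consequences for POIS and POMIS -/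

variable [Finite V] {G : CausalDiagram V} {Y : V} {T : Set V}

/-- In some SCM, setting the border of a generated set `T` is better than every intervention that
meets `T` or spares a vertex of the border. -/
theorem IsGenerated.exists_optReward_lt (hT : G.IsGenerated Y T) :
    ∃ M : SCM G Y, ∀ W, Y ∉ W → ((W ∩ T).Nonempty ∨ ¬ G.Pa T \ T ⊆ W) →
      M.optReward W < M.optReward (G.Pa T \ T) := by
  obtain ⟨ι, _, exo, hne, hexo⟩ := G.bidir.exists_shared_index
  exact ⟨G.recordSCM Y T exo hexo, fun W hY hW => hT.optReward_recordSCM_lt hexo hne hY hW⟩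

theorem EquivIS.optReward_eq {X X' : Set V} (h : G.EquivIS Y X X') (M : SCM G Y) :
    M.optReward X = M.optReward X' :=
  iSup_congr (h M)

theorem equivIS_border {X : Set V} (hY : Y ∈ T) (hX : ¬ (X ∩ T).Nonempty)
    (hB : G.Pa T \ T ⊆ X) : G.EquivIS Y X (G.Pa T \ T) :=
  fun M x => M.expReward_congr_of_border hY (fun t ht h => hX ⟨t, h, ht⟩) hB x

theorem IsGenerated.isPOIS (hT : G.IsGenerated Y T) {X : Set V} (hX : ¬ (X ∩ T).Nonempty)
    (hB : G.Pa T \ T ⊆ X) : G.IsPOIS Y X := by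
  obtain ⟨M, hM⟩ := hT.exists_optReward_lt
  refine ⟨fun h => hX ⟨Y, h, hT.mem⟩, M, fun W hY hW => ?_⟩
  have hXB := equivIS_border hT.mem hX hB
  rw [hXB.optReward_eq]
  refine hM W hY ?_
  by_contra! hc
  exact hW fun M x => (hXB M x).trans
    (equivIS_border hT.mem (Set.not_nonempty_iff_eq_empty.2 hc.1) hc.2 M x).symm

theorem IsGenerated.isPOMIS (hT : G.IsGenerated Y T) : G.IsPOMIS Y (G.Pa T \ T) := by
  obtain ⟨M, hM⟩ := hT.exists_optReward_lt
  refine ⟨⟨fun h => h.2 hT.mem, ?_⟩, M, fun W hW hne => hM W hW.1 ?_⟩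
  · rintro ⟨X', hX', h⟩
    exact (hM X' (fun h => (hX'.1 h).2 hT.mem) (.inr hX'.2)).ne' (h.optReward_eq M)
  -- Otherwise `W` properly contains the border and is equivalent to it, so it is not minimal.
  · by_contra! hc
    exact hW.2 ⟨_, hc.2.ssubset_of_ne hne.symm,
      equivIS_border hT.mem (Set.not_nonempty_iff_eq_empty.2 hc.1) hc.2⟩

theorem IsPOIS.ib_subset {X : Set V} (h : G.IsPOIS Y X) : (G.removeIncoming X).IB Y ⊆ X := by
  obtain ⟨hX, M, hM⟩ := h
  have hT := G.isGenerated_muct_removeIncoming Y X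
  obtain ⟨N, hN⟩ := hT.exists_optReward_lt
  rw [ib_removeIncoming G hX] at *
  by_contra hB
  have hYW : Y ∉ X ∪ (G.removeIncoming X).IB Y := by
    rintro (h | h)
    exacts [hX h, h.2 hT.mem]
  -- By the upper bound the union must be equivalent to the POIS `X`; the model `N` refutes this.
  refine (M.optReward_le_optReward_union_ib hX).not_gt (hM _ hYW fun hequiv => ?_)
  refine (hN X hX (.inr hB)).ne ?_
  rw [hequiv.optReward_eq]
  refine (equivIS_border hT.mem ?_ ?_).optReward_eq N
  · rintro ⟨t, ht | ht, htT⟩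
    exacts [notMem_of_mem_muct_removeIncoming hX htT ht, ht.2 htT]
  · rw [ib_removeIncoming G hX]
    exact Set.subset_union_right

end CausalDiagram

theorem mainTheorem5 {V : Type*} [Finite V] (G : CausalDiagram V) (Y : V) (X : Set V)
    (hX : Y ∉ X) :
    (G.IsPOIS Y X → (G.removeIncoming X).IB Y ⊆ X) ∧
    ((G.IsPOIS Y X ∧ X ⊆ G.An {Y}) ↔
      ((G.removeIncoming X).IB Y ⊆ X ∧
        X ⊆ G.An ((G.removeIncoming X).MUCT Y) \ (G.removeIncoming X).MUCT Y)) ∧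
    (X = (G.removeIncoming X).IB Y → G.IsPOMIS Y X) := by
  have hT := G.isGenerated_muct_removeIncoming Y X
  have hIB := CausalDiagram.ib_removeIncoming G hX
  refine ⟨fun h => h.ib_subset, ⟨fun ⟨h, hXA⟩ => ⟨h.ib_subset, fun v hv => ⟨?_, fun hvT =>
    CausalDiagram.notMem_of_mem_muct_removeIncoming hX hvT hv⟩⟩, fun ⟨hB, hXA⟩ => ⟨?_, ?_⟩⟩,
    fun h => ?_⟩
  · obtain ⟨s, hs, h⟩ := hXA hv
    exact ⟨s, Set.mem_singleton_iff.1 hs ▸ hT.mem, h⟩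
  · exact hT.isPOIS (fun ⟨v, hv, hvT⟩ => (hXA hv).2 hvT) (hIB ▸ hB)
  · intro v hv
    obtain ⟨t, ht, h⟩ := (hXA hv).1
    exact ⟨Y, rfl, h.trans <|
      Relation.ReflTransGen.mono (fun _ _ h => h.2.2) _ _ (hT.reach t ht)⟩
  · rw [h, hIB]
    exact hT.isPOMIS
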